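/- Let $m,n\ge 2$ be integers, and let $G_{m,n}$ be the group presented by $$G_{m,n}=\bigl\langle s,t_1,\dots,t_m,u_1,\dots,u_n \;\big|\; [s,t_1,\dots,t_m],\ [s,u_1,\dots,u_n],\ [t_i,u_j]\ (1\le i\le m,\ 1\le j\le n)\bigr\rangle ,$$ where $[x_1,x_2,\dots,x_k]$ denotes the cyclic relations $x_1x_2\cdots x_k=x_2\cdots x_kx_1=\cdots=x_kx_1\cdots x_{k-1}$ (all cyclic rotations of the word $x_1\cdots x_k$ are equal; in particular $[t_i,u_j]$ means $t_iu_j=u_jt_i$). Put $\Delta=s\,t_1\cdots t_m\,u_1\cdots u_n\in G_{m,n}$. Then the center of $G_{m,n}$ is generated by $\Delta$ and is isomorphic to $\mathbb Z$. -/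

import Mathlib

namespace LineArrangementGroup

/-- The letters `s, t_1, …, t_m, u_1, …, u_n` (the indices are shifted to start at `0`). -/
inductive Letter (m n : ℕ) : Type
  | s : Letter m n
  | t (i : Fin m) : Letter m n
  | u (j : Fin n) : Letter m n

/-- The element of the free group spelled by a positive word. -/
def word {L : Type} (w : List L) : FreeGroup L :=
  (w.map FreeGroup.of).prod

/-- The cyclic relations `[x_1, …, x_k]`: the word `x_1 x_2 ⋯ x_k` is equal to each of its
cyclic rotations `x_2 ⋯ x_k x_1`, …, `x_k x_1 ⋯ x_{k-1}`. The relation `R = S` is recorded as the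
relator `R * S⁻¹`. -/
def cyclicRelators {L : Type} (w : List L) : Set (FreeGroup L) :=
  {r | ∃ k : ℕ, k < w.length ∧ r = word w * (word (w.rotate k))⁻¹}

/-- The word `t_1 ⋯ t_m`. -/
def tWord (m n : ℕ) : List (Letter m n) := List.ofFn Letter.t

/-- The word `u_1 ⋯ u_n`. -/
def uWord (m n : ℕ) : List (Letter m n) := List.ofFn Letter.u

/-- The defining relations `[s, t_1, …, t_m]`, `[s, u_1, …, u_n]` and `[t_i, u_j]`;
the last one is the cyclic relation of length two, `t_i u_j = u_j t_i`. -/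
def relators (m n : ℕ) : Set (FreeGroup (Letter m n)) :=
  cyclicRelators (Letter.s :: tWord m n) ∪
  cyclicRelators (Letter.s :: uWord m n) ∪
  ⋃ (i : Fin m) (j : Fin n), cyclicRelators [Letter.t i, Letter.u j]

/-- The presented group `G_{m,n}`. -/
abbrev G (m n : ℕ) : Type := PresentedGroup (relators m n)

/-- The element `Δ = s t_1 ⋯ t_m u_1 ⋯ u_n` of `G_{m,n}`. -/
def Δ (m n : ℕ) : G m n :=
  PresentedGroup.mk (relators m n) (word (Letter.s :: (tWord m n ++ uWord m n)))

end LineArrangementGroup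

/-!
The group `G m n` is a direct product `ℤ × F_m × F_n` of an infinite cyclic group and two free
groups, and `Δ` corresponds to a generator of the cyclic factor.

The cyclic relations of a word `x₁ ⋯ x_k` say exactly that the product `x₁ ⋯ x_k` commutes with
every `x_i` (`rotate_prod_eq_iff_commute`). Write `T = t₁ ⋯ t_m` and `U = u₁ ⋯ u_n`. The relations
of `G m n` then say that `s T` commutes with `s` and all `t_i`, that `s U` commutes with `s` and
all `u_j`, and that each `t_i` commutes with each `u_j`. Hence `Δ = (s T) U = T (s U)` is central
(`Δ_mem_center`). Since `s = Δ T⁻¹ U⁻¹`, the generator `s` may be traded for `Δ`, and what remains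
is the product of the cyclic group on `Δ` with the free groups on the `t_i` and on the `u_j`
(`equivProd`). A free group on at least two letters has trivial center (`freeGroup_center_eq_bot`),
so for `m, n ≥ 2` the center is the cyclic factor.
-/

namespace LineArrangementGroup

open FreeGroup (of)

/-- All rotations of a list in a group have the same product if and only if this product commutes
with every entry: moving the first `k` entries to the end conjugates the product by their
product. -/
theorem rotate_prod_eq_iff_commute {H : Type*} [Group H] (l : List H) :
    (∀ k < l.length, (l.rotate k).prod = l.prod) ↔ ∀ x ∈ l, Commute x l.prod := by
  have key : ∀ k ≤ l.length, (l.take k).prod * (l.rotate k).prod =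
      l.prod * (l.take k).prod := by
    intro k hk
    rw [List.rotate_eq_drop_append_take hk, List.prod_append, ← mul_assoc,
      List.prod_take_mul_prod_drop]
  constructor
  · intro h x hx
    have hc : ∀ k ≤ l.length, Commute (l.take k).prod l.prod := by
      intro k hk
      rcases hk.lt_or_eq with hk' | rfl
      · have := key k hk
        rwa [h k hk'] at this
      · simp
    obtain ⟨k, hk, rfl⟩ := List.getElem_of_mem hx
    have hsucc := hc (k + 1) hk
    rw [List.prod_take_succ l k hk] at hsucc
    simpa using (hc k hk.le).inv_left.mul_left hsucc
  · intro h k hk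
    have hc : Commute (l.take k).prod l.prod :=
      Commute.list_prod_left _ _ fun x hx => h x (List.mem_of_mem_take hx)
    exact mul_left_cancel ((key k hk.le).trans hc.eq.symm)

theorem map_word {L : Type} {H : Type*} [Group H] (f : FreeGroup L →* H) (w : List L) :
    f (word w) = (w.map fun x => f (of x)).prod := by
  rw [word, map_list_prod, List.map_map]
  rfl

/-- A homomorphism kills the cyclic relators of a word if and only if the image of the word
commutes with the images of its letters. -/
theorem map_cyclicRelators_eq_one_iff {L : Type} {H : Type*} [Group H] (f : FreeGroup L →* H)
    (w : List L) :
    (∀ r ∈ cyclicRelators w, f r = 1) ↔ ∀ x ∈ w, Commute (f (of x)) (f (word w)) := by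
  have h := rotate_prod_eq_iff_commute (w.map fun x => f (of x))
  simp only [List.length_map, ← List.map_rotate, ← map_word, List.forall_mem_map] at h
  rw [← h]
  constructor
  · intro hr k hk
    have := hr _ ⟨k, hk, rfl⟩
    rw [map_mul, map_inv, mul_inv_eq_one] at this
    exact this.symm
  · rintro hr _ ⟨k, hk, rfl⟩
    rw [map_mul, map_inv, mul_inv_eq_one, hr k hk]

/-! ### The center of a free group -/

/-- A reduced nonempty word `L` is lengthened by conjugating with a letter that differs from the
last letter of `L` and whose sign is chosen not to cancel against the first one. -/
theorem freeGroup_center_eq_bot (α : Type*) [Nontrivial α] :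
    Subgroup.center (FreeGroup α) = ⊥ := by
  classical
  rw [eq_bot_iff]
  intro z hz
  rw [Subgroup.mem_bot, ← FreeGroup.toWord_eq_nil_iff]
  by_contra hne
  obtain ⟨b, hb⟩ := exists_ne (z.toWord.getLast hne).1
  obtain ⟨e, he⟩ : ∃ e : Bool, b = (z.toWord.head hne).1 → e = (z.toWord.head hne).2 :=
    ⟨_, fun _ => rfl⟩
  have hred : FreeGroup.IsReduced ((b, e) :: (z.toWord ++ [(b, !e)])) := by
    have hz := FreeGroup.isReduced_toWord (x := z)
    rw [FreeGroup.IsReduced, List.isChain_cons, List.isChain_append]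
    refine ⟨fun y hy => ?_, hz, List.isChain_singleton _, fun x hx y hy h => ?_⟩
    · rw [List.head?_append_of_ne_nil _ hne, List.head?_eq_some_head hne] at hy
      obtain rfl : _ = y := by simpa using hy
      exact he
    · rw [List.getLast?_eq_some_getLast hne] at hx
      obtain rfl : _ = x := by simpa using hx
      obtain rfl : _ = y := by simpa using hy
      exact absurd h.symm hb
  have hconj : FreeGroup.mk ((b, e) :: (z.toWord ++ [(b, !e)])) = z := by
    have h := Subgroup.mem_center_iff.1 hz (FreeGroup.mk [(b, e)])
    have hi : FreeGroup.mk [(b, !e)] = (FreeGroup.mk [(b, e)])⁻¹ := by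
      simp [FreeGroup.inv_mk, FreeGroup.invRev]
    calc FreeGroup.mk ((b, e) :: (z.toWord ++ [(b, !e)]))
        = FreeGroup.mk [(b, e)] * FreeGroup.mk z.toWord * FreeGroup.mk [(b, !e)] := by
          simp [FreeGroup.mul_mk]
      _ = z := by rw [FreeGroup.mk_toWord, hi, h, mul_inv_cancel_right]
  have hlen := congrArg (fun x => x.toWord.length) hconj
  simp only [FreeGroup.toWord_mk, hred.reduce_eq, List.length_cons, List.length_append,
    List.length_nil] at hlen
  lia

/-! ### The relations in `G m n` -/

variable {m n : ℕ}

/-- The product `t₁ ⋯ t_m` in `G m n`. -/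
def tProd (m n : ℕ) : G m n := PresentedGroup.mk (relators m n) (word (tWord m n))

/-- The product `u₁ ⋯ u_n` in `G m n`. -/
def uProd (m n : ℕ) : G m n := PresentedGroup.mk (relators m n) (word (uWord m n))

theorem word_cons {L : Type} (x : L) (w : List L) : word (x :: w) = of x * word w := by
  simp [word]

theorem word_append {L : Type} (v w : List L) : word (v ++ w) = word v * word w := by
  simp [word]

/-- The relations of `G m n` in the form of commutation relations, for a homomorphism `f` out of
the free group on the letters. -/
theorem map_relators_eq_one_iff {H : Type*} [Group H] (f : FreeGroup (Letter m n) →* H) :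
    (∀ r ∈ relators m n, f r = 1) ↔
      (Commute (f (of .s)) (f (of .s) * f (word (tWord m n))) ∧
        ∀ i, Commute (f (of (.t i))) (f (of .s) * f (word (tWord m n)))) ∧
      (Commute (f (of .s)) (f (of .s) * f (word (uWord m n))) ∧
        ∀ j, Commute (f (of (.u j))) (f (of .s) * f (word (uWord m n)))) ∧
      ∀ i j, Commute (f (of (.t i))) (f (of (.u j))) := by
  have ht := map_cyclicRelators_eq_one_iff f (.s :: tWord m n)
  have hu := map_cyclicRelators_eq_one_iff f (.s :: uWord m n)
  have htu : ∀ i j, (∀ r ∈ cyclicRelators [Letter.t (m := m) (n := n) i, .u j], f r = 1) ↔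
      Commute (f (of (.t i))) (f (of (.u j))) := by
    intro i j
    rw [map_cyclicRelators_eq_one_iff]
    simp only [word, List.map_cons, List.map_nil, List.prod_cons, List.prod_nil, mul_one, map_mul,
      List.mem_cons, List.not_mem_nil, or_false, forall_eq_or_imp, forall_eq]
    constructor
    · intro h
      simpa using (Commute.refl (f (of (Letter.t i)))).inv_right.mul_right h.1
    · intro h
      exact ⟨(Commute.refl _).mul_right h, h.symm.mul_right (Commute.refl _)⟩
  rw [tWord, word_cons, map_mul, List.forall_mem_cons, List.forall_mem_ofFn_iff] at ht
  rw [uWord, word_cons, map_mul, List.forall_mem_cons, List.forall_mem_ofFn_iff] at hu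
  simp only [tWord, uWord, ← ht, ← hu, ← htu]
  simp only [relators, Set.mem_union, Set.mem_iUnion, tWord, uWord]
  grind

theorem relations (m n : ℕ) :
    (Commute (.of .s : G m n) (.of .s * tProd m n) ∧
        ∀ i, Commute (.of (.t i) : G m n) (.of .s * tProd m n)) ∧
      (Commute (.of .s : G m n) (.of .s * uProd m n) ∧
        ∀ j, Commute (.of (.u j) : G m n) (.of .s * uProd m n)) ∧
      ∀ i j, Commute (.of (.t i) : G m n) (.of (.u j)) :=
  (map_relators_eq_one_iff (PresentedGroup.mk (relators m n))).1 fun _ => PresentedGroup.one_of_mem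

theorem tProd_eq : tProd m n = (List.ofFn fun i => (.of (.t i) : G m n)).prod := by
  rw [tProd, map_word, tWord, List.map_ofFn]
  rfl

theorem uProd_eq : uProd m n = (List.ofFn fun j => (.of (.u j) : G m n)).prod := by
  rw [uProd, map_word, uWord, List.map_ofFn]
  rfl

theorem commute_t_uProd (i : Fin m) : Commute (.of (.t i) : G m n) (uProd m n) := by
  rw [uProd_eq]
  exact Commute.list_prod_right _ _ ((List.forall_mem_ofFn_iff).2 ((relations m n).2.2 i))

theorem commute_tProd_u (j : Fin n) : Commute (tProd m n) (.of (.u j) : G m n) := by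
  rw [tProd_eq]
  exact Commute.list_prod_left _ _
    ((List.forall_mem_ofFn_iff).2 fun i => (relations m n).2.2 i j)

theorem commute_tProd_uProd : Commute (tProd m n) (uProd m n) := by
  rw [uProd_eq]
  exact Commute.list_prod_right _ _ ((List.forall_mem_ofFn_iff).2 commute_tProd_u)

theorem Δ_eq : Δ m n = .of .s * tProd m n * uProd m n := by
  rw [Δ, word_cons, word_append, map_mul, map_mul, ← mul_assoc]
  rfl

theorem Δ_mem_center (m n : ℕ) : Δ m n ∈ Subgroup.center (G m n) := by
  obtain ⟨⟨hs, ht⟩, ⟨hs', hu⟩, -⟩ := relations m n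
  have hsu : Commute (.of .s : G m n) (uProd m n) := by
    simpa using (Commute.refl (.of .s : G m n)).inv_right.mul_right hs'
  have hst : Commute (.of .s : G m n) (tProd m n) := by
    simpa using (Commute.refl (.of .s : G m n)).inv_right.mul_right hs
  have hΔ : Δ m n = tProd m n * (.of .s * uProd m n) := by
    rw [Δ_eq, hst.eq, mul_assoc]
  suffices h : ∀ g : G m n, Commute g (Δ m n) from Subgroup.mem_center_iff.2 h
  intro g
  have hg : g ∈ Subgroup.centralizer {Δ m n} := by
    refine PresentedGroup.generated_by _ _ (fun x => ?_) g
    rw [Subgroup.mem_centralizer_singleton_iff]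
    cases x with
    | s => rw [Δ_eq]; exact (hs.mul_right hsu).eq
    | t i => rw [Δ_eq]; exact ((ht i).mul_right (commute_t_uProd i)).eq
    | u j => rw [hΔ]; exact ((commute_tProd_u j).symm.mul_right (hu j)).eq
  exact (Subgroup.mem_centralizer_singleton_iff.1 hg)

/-! ### The decomposition as a direct product -/

/-- The product of all letters of the free group on `Fin k`, in increasing order. -/
def freeProd (k : ℕ) : FreeGroup (Fin k) := (List.ofFn of).prod

/-- The images of the letters in `ℤ × F_m × F_n`. The value at `s` is forced by
`s = Δ (t₁ ⋯ t_m)⁻¹ (u₁ ⋯ u_n)⁻¹` once `Δ` is sent to the generator of `ℤ`. -/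
def letterImage :
    Letter m n → Multiplicative ℤ × FreeGroup (Fin m) × FreeGroup (Fin n)
  | .s => (.ofAdd 1, (freeProd m)⁻¹, (freeProd n)⁻¹)
  | .t i => (1, of i, 1)
  | .u j => (1, 1, of j)

theorem lift_letterImage_tWord :
    FreeGroup.lift letterImage (word (tWord m n)) = (1, freeProd m, 1) := by
  have h := map_list_prod ((MonoidHom.inr (Multiplicative ℤ) _).comp
    (MonoidHom.inl (FreeGroup (Fin m)) (FreeGroup (Fin n)))) (List.ofFn of)
  rw [List.map_ofFn] at h
  rw [map_word, tWord, List.map_ofFn]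
  simpa [Function.comp_def, letterImage, freeProd] using h.symm

theorem lift_letterImage_uWord :
    FreeGroup.lift letterImage (word (uWord m n)) = (1, 1, freeProd n) := by
  have h := map_list_prod ((MonoidHom.inr (Multiplicative ℤ) _).comp
    (MonoidHom.inr (FreeGroup (Fin m)) (FreeGroup (Fin n)))) (List.ofFn of)
  rw [List.map_ofFn] at h
  rw [map_word, uWord, List.map_ofFn]
  simpa [Function.comp_def, letterImage, freeProd] using h.symm

theorem lift_letterImage_relators :
    ∀ r ∈ relators m n, FreeGroup.lift letterImage r = 1 := by
  rw [map_relators_eq_one_iff, lift_letterImage_tWord, lift_letterImage_uWord]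
  simp [letterImage, Prod.commute_iff]

/-- The homomorphism `G m n → ℤ × F_m × F_n` that sends `Δ` to the generator of `ℤ` and the letters
`t_i`, `u_j` to the free generators. -/
def toProd (m n : ℕ) :
    G m n →* Multiplicative ℤ × FreeGroup (Fin m) × FreeGroup (Fin n) :=
  PresentedGroup.toGroup lift_letterImage_relators

theorem toProd_Δ : toProd m n (Δ m n) = (.ofAdd 1, 1, 1) := by
  have h : toProd m n (Δ m n) =
      FreeGroup.lift letterImage (word (.s :: (tWord m n ++ uWord m n))) := rfl
  rw [h, word_cons, word_append, map_mul, map_mul, lift_letterImage_tWord,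
    lift_letterImage_uWord]
  simp [letterImage]

theorem commute_lift_t_lift_u (x : FreeGroup (Fin m)) (y : FreeGroup (Fin n)) :
    Commute (FreeGroup.lift (fun i => (.of (.t i) : G m n)) x)
      (FreeGroup.lift (fun j => (.of (.u j) : G m n)) y) := by
  induction x using FreeGroup.induction_on with
  | C1 => simp
  | of i =>
    induction y using FreeGroup.induction_on with
    | C1 => simp
    | of j => simpa using (relations m n).2.2 i j
    | inv_of j h => simpa using h
    | mul a b ha hb => rw [map_mul]; exact ha.mul_right hb
  | inv_of i h => rw [map_inv]; exact h.inv_left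
  | mul a b ha hb => rw [map_mul]; exact ha.mul_left hb

/-- The inverse of `toProd`. -/
def ofProd (m n : ℕ) :
    Multiplicative ℤ × FreeGroup (Fin m) × FreeGroup (Fin n) →* G m n :=
  (zpowersHom (G m n) (Δ m n)).noncommCoprod
    ((FreeGroup.lift fun i => .of (.t i)).noncommCoprod (FreeGroup.lift fun j => .of (.u j))
      commute_lift_t_lift_u)
    fun k _ => ((Subgroup.mem_center_iff.1
      (Subgroup.zpow_mem _ (Δ_mem_center m n) k.toAdd)) _).symm

theorem ofProd_apply (k : Multiplicative ℤ) (x : FreeGroup (Fin m)) (y : FreeGroup (Fin n)) :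
    ofProd m n (k, x, y) = Δ m n ^ k.toAdd *
      (FreeGroup.lift (fun i => .of (.t i)) x * FreeGroup.lift (fun j => .of (.u j)) y) :=
  rfl

theorem ofProd_comp_toProd : (ofProd m n).comp (toProd m n) = MonoidHom.id _ := by
  have ht : FreeGroup.lift (fun i => (.of (.t i) : G m n)) (freeProd m) = tProd m n := by
    rw [freeProd, map_list_prod, List.map_ofFn, tProd_eq]
    simp [Function.comp_def]
  have hu : FreeGroup.lift (fun j => (.of (.u j) : G m n)) (freeProd n) = uProd m n := by
    rw [freeProd, map_list_prod, List.map_ofFn, uProd_eq]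
    simp [Function.comp_def]
  refine PresentedGroup.ext fun x => ?_
  rw [MonoidHom.comp_apply, toProd, PresentedGroup.toGroup.of]
  cases x with
  | s =>
    have h := (commute_tProd_uProd (m := m) (n := n)).eq
    simp only [letterImage, ofProd_apply, map_inv, ht, hu, Δ_eq, toAdd_ofAdd, zpow_one,
      MonoidHom.id_apply]
    rw [mul_assoc (PresentedGroup.of _), h, ← mul_inv_rev, mul_inv_cancel_right]
  | t i => simp [letterImage, ofProd_apply]
  | u j => simp [letterImage, ofProd_apply]

theorem toProd_comp_ofProd : (toProd m n).comp (ofProd m n) = MonoidHom.id _ := by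
  have ht (i : Fin m) : toProd m n (.of (.t i)) = (1, of i, 1) :=
    PresentedGroup.toGroup.of lift_letterImage_relators
  have hu (j : Fin n) : toProd m n (.of (.u j)) = (1, 1, of j) :=
    PresentedGroup.toGroup.of lift_letterImage_relators
  have hx (x : FreeGroup (Fin m)) :
      toProd m n (FreeGroup.lift (fun i => .of (.t i)) x) = (1, x, 1) := by
    have h : (toProd m n).comp (FreeGroup.lift fun i => .of (.t i)) =
        (MonoidHom.inr _ _).comp (MonoidHom.inl _ _) := FreeGroup.ext_hom _ _ fun i => by simp [ht]
    exact DFunLike.congr_fun h x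
  have hy (y : FreeGroup (Fin n)) :
      toProd m n (FreeGroup.lift (fun j => .of (.u j)) y) = (1, 1, y) := by
    have h : (toProd m n).comp (FreeGroup.lift fun j => .of (.u j)) =
        (MonoidHom.inr _ _).comp (MonoidHom.inr _ _) := FreeGroup.ext_hom _ _ fun j => by simp [hu]
    exact DFunLike.congr_fun h y
  refine MonoidHom.ext fun ⟨k, x, y⟩ => ?_
  simp [ofProd_apply, hx, hy, toProd_Δ, ← ofAdd_zsmul]

/-- `G m n` is the direct product of the cyclic group on `Δ` and the free groups on the `t_i` and
on the `u_j`. -/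
def equivProd (m n : ℕ) :
    G m n ≃* Multiplicative ℤ × FreeGroup (Fin m) × FreeGroup (Fin n) :=
  (toProd m n).toMulEquiv (ofProd m n) ofProd_comp_toProd toProd_comp_ofProd

/-! ### The center of `G m n` -/

theorem center_eq_zpowers_Δ {m n : ℕ} (hm : 2 ≤ m) (hn : 2 ≤ n) :
    Subgroup.center (G m n) = Subgroup.zpowers (Δ m n) := by
  have : Nontrivial (Fin m) := Fin.nontrivial_iff_two_le.2 hm
  have : Nontrivial (Fin n) := Fin.nontrivial_iff_two_le.2 hn
  refine le_antisymm (fun z hz => ?_) ((Subgroup.zpowers_le).2 (Δ_mem_center m n))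
  have hc (x) : Commute x (equivProd m n z) := by
    have h := congrArg (equivProd m n) (Subgroup.mem_center_iff.1 hz ((equivProd m n).symm x))
    rwa [map_mul, map_mul, MulEquiv.apply_symm_apply] at h
  obtain ⟨⟨k, x, y⟩, hk⟩ : ∃ p, equivProd m n z = p := ⟨_, rfl⟩
  rw [hk] at hc
  have hx : x ∈ Subgroup.center (FreeGroup (Fin m)) :=
    Subgroup.mem_center_iff.2 fun g => congrArg (fun p => p.2.1) (hc (1, g, 1)).eq
  have hy : y ∈ Subgroup.center (FreeGroup (Fin n)) :=
    Subgroup.mem_center_iff.2 fun g => congrArg (fun p => p.2.2) (hc (1, 1, g)).eq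
  rw [freeGroup_center_eq_bot, Subgroup.mem_bot] at hx hy
  refine ⟨k.toAdd, (equivProd m n).injective ?_⟩
  have hΔ : equivProd m n (Δ m n) = (.ofAdd 1, 1, 1) := toProd_Δ
  simp only [map_zpow, hΔ, hk, hx, hy, Prod.pow_mk, one_zpow]
  rw [← ofAdd_zsmul]
  simp

theorem zpowersHom_Δ_injective (m n : ℕ) :
    Function.Injective (zpowersHom (G m n) (Δ m n)) := by
  refine Function.Injective.of_comp (f := fun g => (toProd m n g).1) fun a b h => ?_
  simpa [toProd_Δ, ← ofAdd_zsmul] using h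

end LineArrangementGroup

/-- For `m, n ≥ 2` the center of `G_{m,n}` is generated by `Δ` and is isomorphic to `ℤ`. -/
theorem proposition5p4 (m n : ℕ) (hm : 2 ≤ m) (hn : 2 ≤ n) :
    Subgroup.center (LineArrangementGroup.G m n) =
        Subgroup.zpowers (LineArrangementGroup.Δ m n) ∧
      Nonempty (Subgroup.center (LineArrangementGroup.G m n) ≃* Multiplicative ℤ) := by
  have hc := LineArrangementGroup.center_eq_zpowers_Δ hm hn
  have e := MonoidHom.ofInjective (LineArrangementGroup.zpowersHom_Δ_injective m n)
  exact ⟨hc, ⟨(MulEquiv.subgroupCongr hc).trans e.symm⟩⟩
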